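/- All topological groups are assumed to be Hausdorff. A topological group $G$ is \emph{$h$-complete} if for every continuous homomorphism $\varphi\colon G\to L$ into a topological group $L$ the image $\varphi(G)$ is closed in $L$; it is \emph{hereditarily $h$-complete} if every closed subgroup of $G$ is $h$-complete. A subset $F$ of a topological space $X$ is \emph{$\omega$-closed} if $\overline{C}\subseteq F$ for every countable subset $C\subseteq F$, and $X$ has \emph{countable tightness} if every $\omega$-closed subset of $X$ is closed. A map is \emph{$k$-continuous} if its restriction to every compact subspace of its domain is continuous; a topological group $H$ is a \emph{$k$-group} if every $k$-continuous homomorphism from $H$ into a topological group is continuous. \textbf{Theorem.} Let $G$ be a hereditarily $h$-complete topological group, and let $f\colon G\to H$ be a continuous homomorphism onto a topological group $H$. If either (a) $H$ has countable tightness, or (b) $H$ is a $k$-group, then $f$ is open. -/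

import Mathlib

universe u v

/-- A topological group `G` is *h-complete* if for every continuous homomorphism `φ : G → L` into a
Hausdorff topological group, the image `φ(G)` is closed in `L`.

It suffices to let `L` range over the universe of `G`: a point of the closure of `φ(G)` in the
Hausdorff group `L` is the limit of an ultrafilter on `φ(G)`, so this closure has at most
`2 ^ 2 ^ |G|` elements and is isomorphic to a topological group in that universe. -/
def IsHComplete (G : Type u) [Group G] [TopologicalSpace G] : Prop :=
  ∀ (L : Type u) [Group L] [TopologicalSpace L] [IsTopologicalGroup L] [T2Space L] (φ : G →* L),
    Continuous φ → IsClosed (Set.range φ)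

/-- A topological group is *hereditarily h-complete* if each of its closed subgroups, with the
subspace topology, is h-complete. -/
def IsHereditarilyHComplete (G : Type u) [Group G] [TopologicalSpace G] : Prop :=
  ∀ S : Subgroup G, IsClosed (S : Set G) → IsHComplete S

/-- A subset `F` of a topological space is *ω-closed* if it contains the closure of each of its
countable subsets. -/
def IsOmegaClosed {X : Type u} [TopologicalSpace X] (F : Set X) : Prop :=
  ∀ C : Set X, C.Countable → C ⊆ F → closure C ⊆ F

/-- A topological space has *countable tightness* if each of its ω-closed subsets is closed. -/
def HasCountableTightness (X : Type u) [TopologicalSpace X] : Prop :=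
  ∀ F : Set X, IsOmegaClosed F → IsClosed F

/-- A map is *k-continuous* if its restriction to every compact subspace is continuous. -/
def IsKContinuous {X : Type u} {Y : Type v} [TopologicalSpace X] [TopologicalSpace Y]
    (f : X → Y) : Prop :=
  ∀ K : Set X, IsCompact K → ContinuousOn f K

/-- A topological group `H` is a *k-group* if every k-continuous homomorphism from `H` into a
Hausdorff topological group is continuous.

It suffices to let `L` range over the universe of `H`, since `L` may be replaced by the image
of `φ`. -/
def IsKGroup (H : Type u) [Group H] [TopologicalSpace H] : Prop :=
  ∀ (L : Type u) [Group L] [TopologicalSpace L] [IsTopologicalGroup L] [T2Space L] (φ : H →* L),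
    IsKContinuous φ → Continuous φ

/-! Completeness drives the proof: every group topology coarser than an h-complete one, Hausdorff or
not, is Raikov complete (`IsHComplete.isRaikovComplete`). If the group is separable and the coarser
topology first-countable, it is also second-countable and Baire. An open mapping theorem then shows
that two comparable topologies of this kind with the same closure of `1` coincide. Since
first-countable topologies recover every neighbourhood of `1` in a separable group, a separable
h-complete group is determined by its closed normal subgroups among coarser group topologies
(`IsHComplete.le_of_isClosed_normal`). Hereditary h-completeness keeps images of closed subgroups
closed, so injective continuous homomorphisms from separable groups are closed embeddings.

A general `G` is reached through its separable closed subgroups, which capture all countable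
subsets. In case (a) they make images of saturated closed sets ω-closed, hence closed, so `f` is a
quotient map. In case (b), after dividing by the kernel, they make preimages of compact sets
compact, so the inverse is k-continuous. -/

open Filter Set
open scoped Topology Uniformity Pointwise

/-! ### Group topologies from neighbourhood filters of the identity. -/

section GroupFilters

variable {G : Type*} [Group G]

theorem exists_isTopologicalGroup_nhds_one_eq (A : Filter G) (h1 : pure 1 ≤ A)
    (hmul : Tendsto (fun p : G × G ↦ p.1 * p.2) (A ×ˢ A) A) (hinv : Tendsto (fun x ↦ x⁻¹) A A)
    (hconj : ∀ x : G, Tendsto (fun y ↦ x * y * x⁻¹) A A) :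
    ∃ t : TopologicalSpace G, @IsTopologicalGroup G t _ ∧ @nhds G t 1 = A := by
  let B : GroupFilterBasis G :=
    { sets := A.sets
      nonempty := ⟨univ, univ_mem⟩
      inter_sets := fun {U V} hU hV ↦ ⟨U ∩ V, inter_mem hU hV, Subset.rfl⟩
      one' := fun hU ↦ h1 hU
      mul' := fun {U} hU ↦ by
        obtain ⟨V, hV, hVU⟩ := (A.basis_sets.prod_self.tendsto_left_iff).1 hmul U hU
        refine ⟨V, hV, ?_⟩
        rintro _ ⟨a, ha, b, hb, rfl⟩
        exact hVU (mk_mem_prod ha hb)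
      inv' := fun {U} hU ↦ ⟨_, hinv hU, Subset.rfl⟩
      conj' := fun x {U} hU ↦ ⟨_, hconj x hU, Subset.rfl⟩ }
  refine ⟨B.topology, B.isTopologicalGroup, ?_⟩
  refine (B.nhds_one_hasBasis).eq_of_same_basis ?_
  exact A.basis_sets

theorem le_of_nhds_one_le {s t : TopologicalSpace G} (hs : @IsTopologicalGroup G s _)
    (ht : @IsTopologicalGroup G t _) (h : @nhds G s 1 ≤ @nhds G t 1) : s ≤ t := by
  rw [← continuous_id_iff_le]
  refine @continuous_of_continuousAt_one G s _ _ G (G →* G) _ t ht.toContinuousMul _ _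
    (MonoidHom.id G) ?_
  simpa [ContinuousAt, Tendsto] using h

end GroupFilters

/-! ### Raikov completeness of h-complete groups. -/

section Raikov

variable {G : Type*} [Group G] [TopologicalSpace G]

/-- A filter on a group is Cauchy for the two-sided (Raikov) uniformity. -/
def IsRaikovCauchy (F : Filter G) : Prop :=
  Tendsto (fun p : G × G ↦ p.1⁻¹ * p.2) (F ×ˢ F) (𝓝 1) ∧
    Tendsto (fun p : G × G ↦ p.1 * p.2⁻¹) (F ×ˢ F) (𝓝 1)

variable (G) in
/-- Every filter that is Cauchy for the two-sided (Raikov) uniformity converges. -/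
def IsRaikovComplete : Prop :=
  ∀ F : Filter G, F.NeBot → IsRaikovCauchy F → ∃ x, F ≤ 𝓝 x

theorem IsRaikovCauchy.inv {F : Filter G} (hF : IsRaikovCauchy F) :
    IsRaikovCauchy (map (fun x ↦ x⁻¹) F) := by
  constructor
  · have := hF.2
    rw [prod_map_map_eq, tendsto_map'_iff]
    simpa [Function.comp_def] using this
  · have := hF.1
    rw [prod_map_map_eq, tendsto_map'_iff]
    simpa [Function.comp_def] using this

theorem IsRaikovCauchy.mono {F F' : Filter G} (hF : IsRaikovCauchy F) (h : F' ≤ F) :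
    IsRaikovCauchy F' :=
  ⟨hF.1.mono_left (prod_mono h h), hF.2.mono_left (prod_mono h h)⟩

variable [IsTopologicalGroup G]

/-- A single `y` with `y⁻¹ * x` near `1` for `F`-most `x` reduces conjugation by all these `x` to
conjugation by `y`, which is continuous. -/
theorem IsRaikovCauchy.tendsto_conj {F : Filter G} [F.NeBot] (hF : IsRaikovCauchy F) :
    Tendsto (fun p : G × G ↦ p.1⁻¹ * p.2 * p.1) (F ×ˢ 𝓝 1) (𝓝 1) := by
  intro U hU
  have hcont : Tendsto (fun p : G × G ↦ p.1⁻¹ * p.2 * p.1) (𝓝 1 ×ˢ 𝓝 1) (𝓝 1) := by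
    have : Continuous (fun p : G × G ↦ p.1⁻¹ * p.2 * p.1) := by fun_prop
    simpa [nhds_prod_eq] using this.tendsto (1, 1)
  obtain ⟨V, hV, W, hW, hVW⟩ := mem_prod_iff.1 (hcont hU)
  obtain ⟨y, hy⟩ := (Filter.Eventually.curry (hF.1.eventually_mem hV)).exists
  have hc : Tendsto (fun v ↦ y⁻¹ * v * y) (𝓝 1) (𝓝 1) := by
    have : Continuous (fun v ↦ y⁻¹ * v * y) := by fun_prop
    simpa using this.tendsto 1
  rw [mem_map]
  filter_upwards [prod_mem_prod hy (hc hW)] with p hp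
  have : ((y⁻¹ * p.1, y⁻¹ * p.2 * y) : G × G) ∈ V ×ˢ W := ⟨hp.1, hp.2⟩
  have := hVW this
  simpa [mul_assoc] using this

/-- From `(xy)⁻¹(x'y') = y⁻¹(x⁻¹x')y · y⁻¹y'`, where the first factor is controlled by
`tendsto_conj`. The other half follows by applying this to the inverses in reverse order. -/
theorem IsRaikovCauchy.map_mul {ι : Type*} {F : Filter ι} [F.NeBot] {x y : ι → G}
    (hx : IsRaikovCauchy (map x F)) (hy : IsRaikovCauchy (map y F)) :
    IsRaikovCauchy (map (fun i ↦ x i * y i) F) := by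
  have key : ∀ {x y : ι → G}, IsRaikovCauchy (map x F) → IsRaikovCauchy (map y F) →
      Tendsto (fun p : ι × ι ↦ (x p.1 * y p.1)⁻¹ * (x p.2 * y p.2)) (F ×ˢ F) (𝓝 1) := by
    intro x y hx hy
    have h1 := hx.1
    have h2 := hy.1
    have h3 := hy.tendsto_conj
    rw [prod_map_map_eq, tendsto_map'_iff] at h1 h2
    have h4 : Tendsto (fun p : ι × ι ↦ (y p.1, (x p.1)⁻¹ * x p.2)) (F ×ˢ F)
        (map y F ×ˢ 𝓝 1) := Tendsto.prodMk (tendsto_map.comp tendsto_fst) h1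
    have h5 := (h3.comp h4).mul h2
    rw [mul_one] at h5
    refine h5.congr fun p ↦ ?_
    simp [mul_assoc]
  constructor
  · rw [prod_map_map_eq, tendsto_map'_iff]
    exact key hx hy
  · rw [prod_map_map_eq, tendsto_map'_iff]
    have hx' := hx.inv
    have hy' := hy.inv
    rw [map_map] at hx' hy'
    refine (key hy' hx').congr fun p ↦ ?_
    simp

theorem isRaikovCauchy_nhds (x : G) : IsRaikovCauchy (𝓝 x) := by
  constructor
  · have : Continuous (fun p : G × G ↦ p.1⁻¹ * p.2) := by fun_prop
    simpa [nhds_prod_eq] using this.tendsto (x, x)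
  · have : Continuous (fun p : G × G ↦ p.1 * p.2⁻¹) := by fun_prop
    simpa [nhds_prod_eq] using this.tendsto (x, x)

/-- The functions on the group that map `F` to a Raikov Cauchy filter. -/
def raikovCauchySubgroup (F : Filter G) [F.NeBot] : Subgroup (G → G) where
  carrier := {x | IsRaikovCauchy (map x F)}
  mul_mem' hx hy := hx.map_mul hy
  one_mem' := (isRaikovCauchy_nhds 1).mono (by
    rw [Pi.one_def, Filter.map_const]; exact pure_le_nhds 1)
  inv_mem' hx := by
    have := hx.inv
    rwa [map_map] at this

/-- This is the topology of eventual closeness along `F`. The Cauchy condition on the functions is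
what makes it invariant under conjugation. -/
theorem exists_topology_raikovCauchySubgroup (F : Filter G) [F.NeBot] :
    ∃ t : TopologicalSpace (raikovCauchySubgroup F),
      @IsTopologicalGroup _ t _ ∧ ∀ S : Set (raikovCauchySubgroup F),
        S ∈ @nhds _ t 1 ↔ ∃ U ∈ 𝓝 (1 : G), {x | ∀ᶠ i in F, x.1 i ∈ U} ⊆ S := by
  let A : Filter (raikovCauchySubgroup F) :=
    (𝓝 (1 : G)).lift' fun U ↦ {x | ∀ᶠ i in F, x.1 i ∈ U}
  have hmono : Monotone fun U : Set G ↦ {x : raikovCauchySubgroup F | ∀ᶠ i in F, x.1 i ∈ U} :=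
    fun U V hUV x hx ↦ Eventually.mono hx fun i hi ↦ hUV hi
  have hA : ∀ S, S ∈ A ↔ ∃ U ∈ 𝓝 (1 : G), {x | ∀ᶠ i in F, x.1 i ∈ U} ⊆ S :=
    fun S ↦ mem_lift'_sets hmono
  suffices h : ∃ t : TopologicalSpace (raikovCauchySubgroup F),
      @IsTopologicalGroup _ t _ ∧ @nhds _ t 1 = A by
    obtain ⟨t, ht, htA⟩ := h
    exact ⟨t, ht, fun S ↦ by rw [htA, hA]⟩
  refine exists_isTopologicalGroup_nhds_one_eq A ?_ ?_ ?_ ?_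
  · intro S hS
    obtain ⟨U, hU, hUS⟩ := (hA S).1 hS
    exact hUS (Eventually.of_forall fun i ↦ mem_of_mem_nhds hU)
  · intro S hS
    obtain ⟨U, hU, hUS⟩ := (hA S).1 hS
    obtain ⟨V, hV, hVU⟩ := exists_nhds_one_split hU
    have hVA : {x : raikovCauchySubgroup F | ∀ᶠ i in F, x.1 i ∈ V} ∈ A :=
      (hA _).2 ⟨V, hV, Subset.rfl⟩
    rw [mem_map]
    filter_upwards [prod_mem_prod hVA hVA] with p hp
    apply hUS
    filter_upwards [hp.1, hp.2] with i h1 h2 using hVU _ h1 _ h2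
  · intro S hS
    obtain ⟨U, hU, hUS⟩ := (hA S).1 hS
    have hVA : {x : raikovCauchySubgroup F | ∀ᶠ i in F, x.1 i ∈ U⁻¹} ∈ A :=
      (hA _).2 ⟨U⁻¹, inv_mem_nhds_one G hU, Subset.rfl⟩
    rw [mem_map]
    filter_upwards [hVA] with x hx
    exact hUS hx
  · intro x S hS
    obtain ⟨U, hU, hUS⟩ := (hA S).1 hS
    have hx : IsRaikovCauchy (map (fun i ↦ (x.1 i)⁻¹) F) := (x⁻¹).2
    obtain ⟨P, hP, V, hV, hPV⟩ := mem_prod_iff.1 (hx.tendsto_conj hU)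
    have hVA : {x : raikovCauchySubgroup F | ∀ᶠ i in F, x.1 i ∈ V} ∈ A :=
      (hA _).2 ⟨V, hV, Subset.rfl⟩
    rw [mem_map]
    filter_upwards [hVA] with y hy
    apply hUS
    filter_upwards [hy, hP] with i h1 h2
    have := hPV (mk_mem_prod h2 h1)
    simpa using this

end Raikov

/-- Every group topology coarser than the topology of an h-complete group is Raikov complete. -/
theorem IsHComplete.isRaikovComplete {G : Type*} [Group G] {t s : TopologicalSpace G}
    (hG : @IsHComplete G _ t) (ht : @IsTopologicalGroup G t _) (hs : @IsTopologicalGroup G s _)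
    (hts : t ≤ s) : @IsRaikovComplete G _ s := by
  intro F hF hFc
  obtain ⟨r, hr, hr1⟩ := exists_topology_raikovCauchySubgroup F
  let A := raikovCauchySubgroup F
  let c : G →* A :=
    { toFun := fun g ↦ ⟨fun _ ↦ g, (isRaikovCauchy_nhds g).mono <| by
        rw [Filter.map_const]; exact pure_le_nhds g⟩
      map_one' := rfl
      map_mul' := fun _ _ ↦ rfl }
  have hc : @Continuous G A t r c := by
    refine @continuous_of_continuousAt_one G t _ _ A (G →* A) _ r _ _ _ c ?_
    intro S (hS : S ∈ 𝓝 (c 1))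
    rw [map_one, hr1] at hS
    obtain ⟨U, hU, hUS⟩ := hS
    have hU' : U ∈ @nhds G t 1 := nhds_mono hts hU
    have hUc : U ⊆ c ⁻¹' S := fun g hg ↦ hUS (Eventually.of_forall fun _ ↦ hg)
    exact mem_map.2 (mem_of_superset hU' hUc)
  -- `A` need not be Hausdorff, so h-completeness is applied to its separation quotient.
  let q : A →* SeparationQuotient A := SeparationQuotient.mkMonoidHom
  have hq : Continuous q := SeparationQuotient.continuous_mk
  have hcl := hG (SeparationQuotient A) (q.comp c) 
    (@Continuous.comp _ _ _ t _ _ c q hq hc)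
  -- The identity function is the limit of the constants `c i` along `F`. Closedness of the image
  -- makes it inseparable from some constant `c g`, which says exactly that `F` converges to `g`.
  let e : A := ⟨id, by rw [← Filter.map_id (f := F)] at hFc; exact hFc⟩
  have hlim : Tendsto c F (𝓝 e) := by
    have : Tendsto (fun i ↦ e⁻¹ * c i) F (𝓝 1) := by
      intro S hS
      obtain ⟨U, hU, hUS⟩ := (hr1 S).1 hS
      have h1 := Filter.Eventually.curry (hFc.1.eventually_mem (inv_mem_nhds_one G hU))
      change ∀ᶠ i in F, e⁻¹ * c i ∈ S
      filter_upwards [h1] with i hi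
      apply hUS
      filter_upwards [hi] with j hj
      simpa [e, c] using hj
    have := this.const_mul e
    simpa using this
  have hmem : q e ∈ range (q.comp c) :=
    hcl.mem_of_tendsto ((hq.tendsto e).comp hlim) (Eventually.of_forall fun i ↦ ⟨i, rfl⟩)
  obtain ⟨g, hg⟩ := hmem
  have hins : Inseparable (c g) e := SeparationQuotient.mk_eq_mk.1 hg
  refine ⟨g, ?_⟩
  have h1 : ∀ U ∈ 𝓝 (1 : G), ∀ᶠ i in F, g⁻¹ * i ∈ U := by
    intro U hU
    have hS : {x : A | ∀ᶠ i in F, x.1 i ∈ U} ∈ 𝓝 (1 : A) := (hr1 _).2 ⟨U, hU, Subset.rfl⟩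
    have h2 : Tendsto (fun x ↦ (c g)⁻¹ * x) (𝓝 (c g)) (𝓝 1) := by
      have : Continuous (fun x ↦ (c g)⁻¹ * x) := by fun_prop
      simpa using this.tendsto (c g)
    have h3 := h2 hS
    rw [hins] at h3
    have h4 := mem_of_mem_nhds (mem_map.1 h3)
    exact h4
  have h2 : Tendsto (fun i ↦ g⁻¹ * i) F (𝓝 1) := h1
  simpa [Tendsto] using h2.const_mul g

/-- An image of an h-complete group under a continuous homomorphism is closed. -/
theorem IsHComplete.isClosed_range {G H : Type*} [Group G] [TopologicalSpace G]
    [IsTopologicalGroup G] [Group H] [TopologicalSpace H] [IsTopologicalGroup H] [T2Space H]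
    (hG : IsHComplete G) (f : G →* H) (hf : Continuous f) : IsClosed (range f) := by
  rw [isClosed_iff_clusterPt]
  intro y hy
  let F : Filter G := comap f (𝓝 y)
  have hF : F.NeBot := by
    rw [comap_neBot_iff_frequently]
    exact mem_closure_iff_frequently.1 (mem_closure_iff_clusterPt.2 hy)
  have hmap : map f F ≤ 𝓝 y := map_comap_le
  have hc := (isRaikovCauchy_nhds y).mono hmap
  -- Completeness is used for the topology induced by `f` on `G`, so `H` may live in any universe.
  have hF' : @IsRaikovCauchy G _ (TopologicalSpace.induced f ‹_›) F := by
    have h1 := hc.1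
    have h2 := hc.2
    rw [prod_map_map_eq, tendsto_map'_iff] at h1 h2
    refine ⟨?_, ?_⟩
    · rw [nhds_induced, tendsto_comap_iff, map_one]
      exact h1.congr fun p ↦ by simp
    · rw [nhds_induced, tendsto_comap_iff, map_one]
      exact h2.congr fun p ↦ by simp
  obtain ⟨x, hx⟩ := hG.isRaikovComplete ‹_› (topologicalGroup_induced f)
    (continuous_iff_le_induced.1 hf) F hF hF'
  rw [nhds_induced] at hx
  have : map f F ≤ 𝓝 (f x) := map_le_iff_le_comap.2 hx
  exact ⟨x, tendsto_nhds_unique (f := f) (l := F) this hmap⟩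

/-! ### First-countable coarsenings of separable group topologies. -/

section Separable

variable {G : Type*} [Group G]

theorem exists_mem_mul_of_dense [TopologicalSpace G] [IsTopologicalGroup G] {D : Set G}
    (hD : Dense D) {V : Set G} (hV : V ∈ 𝓝 1) (x : G) : ∃ d ∈ D, ∃ v ∈ V, x = v * d := by
  have hc : Tendsto (fun d ↦ x * d⁻¹) (𝓝 x) (𝓝 1) := by
    have : Continuous (fun d ↦ x * d⁻¹) := by fun_prop
    simpa using this.tendsto x
  obtain ⟨d, hd, hdD⟩ := mem_closure_iff_nhds.1 (hD x) _ (hc hV)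
  exact ⟨d, hdD, x * d⁻¹, hd, by simp⟩

/-- In a separable group, each neighbourhood of `1` is a neighbourhood of `1` for a coarser
first-countable group topology. -/
theorem exists_countablyGenerated_topology [t : TopologicalSpace G] [IsTopologicalGroup G]
    [TopologicalSpace.SeparableSpace G] {U : Set G} (hU : U ∈ 𝓝 1) :
    ∃ s : TopologicalSpace G, @IsTopologicalGroup G s _ ∧ t ≤ s ∧
      (@nhds G s 1).IsCountablyGenerated ∧ U ∈ @nhds G s 1 := by
  obtain ⟨d, hd⟩ := TopologicalSpace.exists_dense_seq G
  have h3 : ∀ U : {U : Set G // U ∈ 𝓝 1}, ∃ V : {V : Set G // V ∈ 𝓝 1},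
      V.1⁻¹ = V.1 ∧ V.1 * V.1 * V.1 ⊆ U.1 := by
    rintro ⟨U, hU⟩
    obtain ⟨W, hW, -, hWi, hWU⟩ := exists_closed_nhds_one_inv_eq_mul_subset hU
    obtain ⟨V, hV, -, hVi, hVW⟩ := exists_closed_nhds_one_inv_eq_mul_subset hW
    refine ⟨⟨V, hV⟩, hVi, ?_⟩
    have : V ⊆ W := fun v hv ↦ hVW ⟨v, hv, 1, mem_of_mem_nhds hV, mul_one v⟩
    exact (mul_subset_mul hVW this).trans hWU
  choose V hVi hVU using h3
  have h4 : ∀ (k : ℕ) (U : {U : Set G // U ∈ 𝓝 1}), ∃ W : {W : Set G // W ∈ 𝓝 1},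
      ∀ w ∈ W.1, d k * w * (d k)⁻¹ ∈ (V U).1 := by
    intro k U
    have hc : Tendsto (fun w ↦ d k * w * (d k)⁻¹) (𝓝 1) (𝓝 1) := by
      have : Continuous (fun w ↦ d k * w * (d k)⁻¹) := by fun_prop
      simpa using this.tendsto 1
    exact ⟨⟨_, hc (V U).2⟩, fun w hw ↦ hw⟩
  choose W hW using h4
  -- Finite words index countably many neighbourhoods: the letter `0` shrinks to `V` with `V³ ⊆ U`,
  -- and `k + 1` shrinks so that conjugation by `d k` lands in `V`.
  let N : List ℕ → {U : Set G // U ∈ 𝓝 1} :=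
    fun l ↦ l.foldr (fun n U ↦ Nat.casesOn n (V U) fun k ↦ W k U) ⟨U, hU⟩
  have hN0 : N [] = ⟨U, hU⟩ := rfl
  have hNV : ∀ l, N (0 :: l) = V (N l) := fun l ↦ rfl
  have hNW : ∀ k l, N ((k + 1) :: l) = W k (N l) := fun k l ↦ rfl
  let A : Filter G := ⨅ l, 𝓟 (N l).1
  have hNA : ∀ l, (N l).1 ∈ A := fun l ↦ mem_iInf_of_mem l (mem_principal_self _)
  have htA : 𝓝 1 ≤ A := le_iInf fun l ↦ le_principal_iff.2 (N l).2
  have hVone : ∀ U, (1 : G) ∈ (V U).1 := fun U ↦ mem_of_mem_nhds (V U).2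
  obtain ⟨s, hs, hsA⟩ := exists_isTopologicalGroup_nhds_one_eq A ((pure_le_nhds 1).trans htA)
    (by
      refine tendsto_iInf.2 fun l ↦ tendsto_principal.2 ?_
      have := hNA (0 :: l)
      filter_upwards [prod_mem_prod this this] with p hp
      refine hVU (N l) ⟨p.1 * p.2, ⟨p.1, hp.1, p.2, hp.2, rfl⟩, 1, hVone _, mul_one _⟩)
    (by
      refine tendsto_iInf.2 fun l ↦ tendsto_principal.2 ?_
      filter_upwards [hNA (0 :: l)] with x hx
      refine hVU (N l) ⟨x⁻¹ * 1, ⟨x⁻¹, ?_, 1, hVone _, rfl⟩, 1, hVone _, by simp⟩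
      rw [← hVi]
      exact inv_mem_inv.2 hx)
    (by
      intro x
      refine tendsto_iInf.2 fun l ↦ tendsto_principal.2 ?_
      -- Writing `x = v * d k` reduces conjugation by `x` to conjugation by `d k`, at the cost of
      -- the outer factors `v` and `v⁻¹` in `V`.
      obtain ⟨_, ⟨k, rfl⟩, v, hv, rfl⟩ := exists_mem_mul_of_dense hd (V (N l)).2 x
      filter_upwards [hNA ((k + 1) :: l)] with w hw
      refine hVU (N l) ⟨v * (d k * w * (d k)⁻¹), ⟨v, hv, _, hW k _ w hw, rfl⟩, v⁻¹, ?_, ?_⟩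
      · rw [← hVi]
        simpa using hv
      · simp [mul_assoc])
  refine ⟨s, hs, le_of_nhds_one_le ‹_› hs (hsA ▸ htA), ?_, ?_⟩
  · rw [hsA]
    infer_instance
  · rw [hsA]
    exact hNA []

theorem separableSpace_of_le {X : Type*} {t s : TopologicalSpace X} (hts : t ≤ s)
    (h : @TopologicalSpace.SeparableSpace X t) : @TopologicalSpace.SeparableSpace X s := by
  obtain ⟨D, hD, hd⟩ := h
  exact @TopologicalSpace.SeparableSpace.mk X s ⟨D, hD, fun x ↦ closure.mono hts (hd x)⟩

theorem secondCountableTopology_of_nhds_one [TopologicalSpace G] [IsTopologicalGroup G]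
    [TopologicalSpace.SeparableSpace G] (hc : (𝓝 (1 : G)).IsCountablyGenerated) :
    SecondCountableTopology G := by
  let := IsTopologicalGroup.rightUniformSpace G
  have : (uniformity G).IsCountablyGenerated :=
    Filter.comap.isCountablyGenerated _ _
  exact UniformSpace.secondCountable_of_separable G

end Separable

/-! ### An open mapping theorem without Hausdorff assumptions. -/

section OpenMapping

variable {G : Type*} [Group G]

/-- A point that keeps adhering to the images of ever smaller sets of a family is, up to
specialization, in the image. -/
theorem exists_specializes_of_generic {H : Type*} [TopologicalSpace G] [Group H]
    [TopologicalSpace H] [IsTopologicalGroup H] {f : G →* H} (hG : IsRaikovComplete G)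
    (hf : Continuous f)
    {b : ℕ → Set G} (hb : (𝓝 (1 : G)).HasBasis (fun _ ↦ True) b) {𝓑 : Set (Set G)} {x : H}
    (hx : ∀ B ∈ 𝓑, ∀ n : ℕ, x ∈ closure (f '' B) → ∃ B' ∈ 𝓑, B' ⊆ B ∧
      (∀ y ∈ B', ∀ z ∈ B', y⁻¹ * z ∈ b n ∧ y * z⁻¹ ∈ b n) ∧ x ∈ closure (f '' B'))
    {B₀ : Set G} (hB₀ : B₀ ∈ 𝓑) (hxB₀ : x ∈ closure (f '' B₀)) :
    ∃ g ∈ closure B₀, x ⤳ f g := by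
  let T := {B : Set G // B ∈ 𝓑 ∧ x ∈ closure (f '' B)}
  have hT : ∀ (n : ℕ) (B : T), ∃ B' : T, B'.1 ⊆ B.1 ∧
      ∀ y ∈ B'.1, ∀ z ∈ B'.1, y⁻¹ * z ∈ b n ∧ y * z⁻¹ ∈ b n := by
    rintro n ⟨B, hB, hxB⟩
    obtain ⟨B', hB', h1, h2, h3⟩ := hx B hB n hxB
    exact ⟨⟨B', hB', h3⟩, h1, h2⟩
  choose S hS hSb using hT
  -- Nested sets, the `(n + 1)`-st being `b n`-small, generate a Cauchy filter; its limit is the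
  -- required point.
  let B : ℕ → T := fun n ↦ Nat.rec ⟨B₀, hB₀, hxB₀⟩ S n
  have hBs : ∀ n, B (n + 1) = S n (B n) := fun n ↦ rfl
  have hanti : Antitone fun n ↦ (B n).1 := antitone_nat_of_succ_le fun n ↦ hS n (B n)
  let F : Filter G := ⨅ n, 𝓟 (B n).1
  have hF : F.HasBasis (fun _ ↦ True) fun n ↦ (B n).1 :=
    hasBasis_iInf_principal (hanti.directed_ge)
  have hne : ∀ n, (B n).1.Nonempty := fun n ↦
    image_nonempty.1 (closure_nonempty_iff.1 ⟨x, (B n).2.2⟩)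
  have hFne : F.NeBot := hF.neBot_iff.2 fun {n} _ ↦ hne n
  have hFc : IsRaikovCauchy F := by
    refine ⟨hF.prod_self.tendsto_iff hb |>.2 fun n _ ↦ ⟨n + 1, trivial, fun p hp ↦ ?_⟩,
      hF.prod_self.tendsto_iff hb |>.2 fun n _ ↦ ⟨n + 1, trivial, fun p hp ↦ ?_⟩⟩
    · exact (hSb n (B n) _ hp.1 _ hp.2).1
    · exact (hSb n (B n) _ hp.1 _ hp.2).2
  obtain ⟨g, hg⟩ := hG F hFne hFc
  refine ⟨g, ?_, ?_⟩
  · rw [mem_closure_iff_clusterPt]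
    exact (ClusterPt.of_le_nhds hg).mono (le_principal_iff.2 (hF.mem_of_mem (i := 0) trivial))
  · rw [specializes_iff_pure]
    intro Y hY
    obtain ⟨Z, hZ, hZc, hZY⟩ := exists_mem_nhds_isClosed_subset hY
    obtain ⟨n, -, hn⟩ := hF.mem_iff.1 (hg (hf.continuousAt hZ))
    exact hZY (closure_minimal (image_subset_iff.2 hn) hZc (B n).2.2)

/-- The infimum of the left and right uniformities induces the given topology and is complete and
countably generated, so Baire's theorem applies. -/
theorem IsRaikovComplete.baireSpace [TopologicalSpace G] [IsTopologicalGroup G]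
    (hG : IsRaikovComplete G) (hc : (𝓝 (1 : G)).IsCountablyGenerated) : BaireSpace G := by
  let u : UniformSpace G :=
    IsTopologicalGroup.leftUniformSpace G ⊓ IsTopologicalGroup.rightUniformSpace G
  have hu : 𝓤[u] = comap (fun p : G × G ↦ p.1⁻¹ * p.2) (𝓝 1) ⊓
      comap (fun p : G × G ↦ p.2 * p.1⁻¹) (𝓝 1) := rfl
  have htop : u.toTopologicalSpace = ‹TopologicalSpace G› := by
    exact UniformSpace.toTopologicalSpace_inf.trans (inf_idem _)
  have hcg : 𝓤[u].IsCountablyGenerated := by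
    rw [hu]
    infer_instance
  have hcomp : @CompleteSpace G u := by
    refine @CompleteSpace.mk G u fun {F} hF ↦ ?_
    have hF2 := hF.2
    rw [hu] at hF2
    obtain ⟨x, hx⟩ := hG F hF.1 ⟨tendsto_iff_comap.2 (hF2.trans inf_le_left), by
      have h1 : Tendsto (fun p : G × G ↦ p.2 * p.1⁻¹) (F ×ˢ F) (𝓝 1) :=
        tendsto_iff_comap.2 (hF2.trans inf_le_right)
      exact h1.comp (tendsto_snd.prodMk tendsto_fst)⟩
    exact ⟨x, by rw [htop]; exact hx⟩
  have hb : @BaireSpace G u.toTopologicalSpace := by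
    let := u
    infer_instance
  rwa [htop] at hb

section

variable {H : Type*} [TopologicalSpace G] [IsTopologicalGroup G] [Group H] [TopologicalSpace H]
  [IsTopologicalGroup H] {f : G →* H}

/-- Countably many right translates of `V` cover `G`, so by Baire the closure of the image of one of
them has interior; quotients of its points lie in the closure of `f '' U`. -/
theorem closure_image_mem_nhds_one [TopologicalSpace.SeparableSpace G] [BaireSpace H]
    (hf : Function.Surjective f) {U : Set G} (hU : U ∈ 𝓝 1) : closure (f '' U) ∈ 𝓝 1 := by
  obtain ⟨V, hV, -, hVi, hVU⟩ := exists_closed_nhds_one_inv_eq_mul_subset hU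
  obtain ⟨d, hd⟩ := TopologicalSpace.exists_dense_seq G
  obtain ⟨n, o, ho⟩ := nonempty_interior_of_iUnion_of_closed
    (f := fun n ↦ closure (f '' ((· * d n) '' V))) (fun n ↦ isClosed_closure) (by
      refine eq_univ_of_forall fun y ↦ ?_
      obtain ⟨x, rfl⟩ := hf y
      obtain ⟨_, ⟨n, rfl⟩, v, hv, rfl⟩ := exists_mem_mul_of_dense hd hV x
      exact mem_iUnion.2 ⟨n, subset_closure ⟨_, ⟨v, hv, rfl⟩, rfl⟩⟩)
  have hc : Tendsto (fun z ↦ z * o) (𝓝 1) (𝓝 o) := by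
    have : Continuous (fun z ↦ z * o) := by fun_prop
    simpa using this.tendsto 1
  filter_upwards [hc (isOpen_interior.mem_nhds ho)] with z hz
  have h : z * o * o⁻¹ ∈ closure (f '' U) := by
    refine map_mem_closure₂ (f := fun a b ↦ a * b⁻¹) (by fun_prop) (interior_subset hz)
      (interior_subset ho) ?_
    rintro _ ⟨_, ⟨v, hv, rfl⟩, rfl⟩ _ ⟨_, ⟨w, hw, rfl⟩, rfl⟩
    refine ⟨v * w⁻¹, hVU ⟨v, hv, w⁻¹, ?_, rfl⟩, by simp [mul_assoc]⟩
    rw [← hVi]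
    exact inv_mem_inv.2 hw
  simpa using h

theorem closure_image_mem_nhds [TopologicalSpace.SeparableSpace G] [BaireSpace H]
    (hf : Function.Surjective f) {g : G} {B : Set G} (hB : B ∈ 𝓝 g) :
    closure (f '' B) ∈ 𝓝 (f g) := by
  have hc : Tendsto (fun x ↦ g * x) (𝓝 1) (𝓝 g) := by
    have : Continuous (fun x ↦ g * x) := by fun_prop
    simpa using this.tendsto 1
  have hc' : Tendsto (fun y ↦ (f g)⁻¹ * y) (𝓝 (f g)) (𝓝 1) := by
    have : Continuous (fun y ↦ (f g)⁻¹ * y) := by fun_prop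
    simpa using this.tendsto (f g)
  filter_upwards [hc' (closure_image_mem_nhds_one hf (hc hB))] with y hy
  have h : f g * ((f g)⁻¹ * y) ∈ closure (f '' B) := by
    refine map_mem_closure (by fun_prop : Continuous fun y ↦ f g * y) hy ?_
    rintro _ ⟨x, hx, rfl⟩
    exact ⟨g * x, hx, map_mul f g x⟩
  simpa using h

/-- The open mapping theorem for a continuous surjective homomorphism whose kernel consists of
points inseparable from `1`. -/
theorem image_mem_nhds_one_of_isRaikovComplete [TopologicalSpace.SeparableSpace G] [BaireSpace H]
    (hc : (𝓝 (1 : G)).IsCountablyGenerated) (hG : IsRaikovComplete G) (hf : Continuous f)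
    (hsurj : Function.Surjective f) (hker : ∀ g, f g ⤳ 1 → g ⤳ 1) {U : Set G} (hU : U ∈ 𝓝 1) :
    f '' U ∈ 𝓝 1 := by
  have := secondCountableTopology_of_nhds_one hc
  obtain ⟨b, hb⟩ := (𝓝 (1 : G)).exists_antitone_basis
  obtain ⟨V, hV, -, hVi, hVU⟩ := exists_closed_nhds_one_inv_eq_mul_subset hU
  obtain ⟨W, hW, hWc, -, hWV⟩ := exists_closed_nhds_one_inv_eq_mul_subset hV
  let 𝓑 := TopologicalSpace.countableBasis G
  have h𝓑 : TopologicalSpace.IsTopologicalBasis 𝓑 := TopologicalSpace.isBasis_countableBasis G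
  obtain ⟨B₀, hB₀, h1B₀, hB₀W⟩ := h𝓑.mem_nhds_iff.1 hW
  let small : ℕ → Set G → Prop := fun n B ↦ ∀ y ∈ B, ∀ z ∈ B, y⁻¹ * z ∈ b n ∧ y * z⁻¹ ∈ b n
  -- A point in all of these countably many dense open sets can always pass from a basic `B` to a
  -- smaller `n`-small one, as `exists_specializes_of_generic` requires.
  let D : 𝓑 × ℕ → Set H := fun p ↦
    (⋃ B ∈ {B ∈ 𝓑 | B ⊆ p.1.1 ∧ small p.2 B}, interior (closure (f '' B))) ∪
      (closure (f '' p.1.1))ᶜ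
  have hDo : ∀ p, IsOpen (D p) := fun p ↦
    (isOpen_biUnion fun _ _ ↦ isOpen_interior).union isClosed_closure.isOpen_compl
  have hDd : ∀ p, Dense (D p) := by
    rintro ⟨⟨B, hB⟩, n⟩ y
    by_cases hy : y ∈ closure (f '' B)
    · refine closure_mono ?_ hy
      rintro _ ⟨g, hg, rfl⟩
      obtain ⟨P, hP, hPn⟩ := (𝓝 g).basis_sets.prod_self.tendsto_left_iff.1
        (isRaikovCauchy_nhds g).1 _ (hb.mem n)
      obtain ⟨Q, hQ, hQn⟩ := (𝓝 g).basis_sets.prod_self.tendsto_left_iff.1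
        (isRaikovCauchy_nhds g).2 _ (hb.mem n)
      obtain ⟨B', hB', hgB', hB'P⟩ := h𝓑.mem_nhds_iff.1
        (inter_mem (inter_mem hP hQ) ((h𝓑.isOpen hB).mem_nhds hg))
      refine Or.inl (mem_biUnion ⟨hB', fun z hz ↦ (hB'P hz).2, fun y hy z hz ↦ ?_⟩
        (mem_interior_iff_mem_nhds.2
          (closure_image_mem_nhds hsurj ((h𝓑.isOpen hB').mem_nhds hgB'))))
      exact ⟨hPn (mk_mem_prod (hB'P hy).1.1 (hB'P hz).1.1),
        hQn (mk_mem_prod (hB'P hy).1.2 (hB'P hz).1.2)⟩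
    · exact subset_closure (Or.inr hy)
  have hgen : ∀ x ∈ ⋂ p, D p, x ∈ closure (f '' B₀) → ∃ g ∈ V, f g = x := by
    intro x hx hxB₀
    obtain ⟨g, hg, hxg⟩ := exists_specializes_of_generic (x := x) hG hf hb.1 (𝓑 := 𝓑) (by
      intro B hB n hxB
      rcases mem_iInter.1 hx (⟨B, hB⟩, n) with h | h
      · obtain ⟨B', ⟨hB', hB'B, hs⟩, hxB'⟩ := mem_iUnion₂.1 h
        exact ⟨B', hB', hB'B, hs, interior_subset hxB'⟩
      · exact absurd hxB h) hB₀ hxB₀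
    -- The limit `g` hits `x` only up to specialization; the kernel hypothesis moves it to an exact
    -- preimage `a` within `g * W`.
    obtain ⟨a, rfl⟩ := hsurj x
    have h1 : f (g⁻¹ * a) ⤳ 1 := by
      have := hxg.map (by fun_prop : Continuous fun y ↦ (f g)⁻¹ * y)
      simpa using this
    have h2 : g⁻¹ * a ∈ W := (specializes_iff_pure.1 (hker _ h1)) hW
    exact ⟨a, hWV ⟨g, closure_minimal hB₀W hWc hg, _, h2, by simp⟩, rfl⟩
  let O := interior (closure (f '' B₀))
  have hO : (1 : H) ∈ O := by
    have := mem_interior_iff_mem_nhds.2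
      (closure_image_mem_nhds hsurj ((h𝓑.isOpen hB₀).mem_nhds h1B₀))
    rwa [map_one] at this
  have hOn : O ∈ 𝓝 (1 : H) := isOpen_interior.mem_nhds hO
  filter_upwards [inv_mem_nhds_one H hOn] with z hz
  have hcz : Continuous fun y : H ↦ z⁻¹ * y := by fun_prop
  have hdense : Dense (⋂ p : (𝓑 × ℕ) ⊕ (𝓑 × ℕ), Sum.elim D (fun p ↦ (z⁻¹ * ·) ⁻¹' D p) p) := by
    have : Countable 𝓑 := TopologicalSpace.countable_countableBasis G
    refine dense_iInter_of_isOpen ?_ ?_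
    · rintro (p | p)
      · exact hDo p
      · exact (hDo p).preimage hcz
    · rintro (p | p)
      · exact hDd p
      · exact (hDd p).preimage (Homeomorph.mulLeft z⁻¹).isOpenMap
  -- Here `x` and `z⁻¹ * x` are both generic and both in `O`; the quotient of their preimages in `V`
  -- is a preimage of `z` in `U`.
  obtain ⟨x, hx, hxD⟩ := hdense.inter_open_nonempty (O ∩ (z⁻¹ * ·) ⁻¹' O)
    (isOpen_interior.inter (isOpen_interior.preimage hcz)) ⟨1, hO, by simpa using hz⟩
  obtain ⟨g, hg, hgx⟩ := hgen x (mem_iInter.2 fun p ↦ mem_iInter.1 hxD (Sum.inl p))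
    (interior_subset hx.1)
  obtain ⟨g', hg', hgx'⟩ := hgen (z⁻¹ * x) (mem_iInter.2 fun p ↦ mem_iInter.1 hxD (Sum.inr p))
    (interior_subset hx.2)
  refine ⟨g * g'⁻¹, hVU ⟨g, hg, g'⁻¹, ?_, rfl⟩, ?_⟩
  · rw [← hVi]
    exact inv_mem_inv.2 hg'
  · rw [map_mul, map_inv, hgx, hgx']
    simp

end

/-- The open mapping theorem for two comparable group topologies. -/
theorem nhds_one_le_of_isRaikovComplete {t s : TopologicalSpace G}
    (ht : @IsTopologicalGroup G t _) (hs : @IsTopologicalGroup G s _) (hts : t ≤ s)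
    (hc : (@nhds G t 1).IsCountablyGenerated) (hsep : @TopologicalSpace.SeparableSpace G t)
    (hcomp : @IsRaikovComplete G _ t) (hb : @BaireSpace G s)
    (hker : ∀ g, @Specializes G s g 1 → @Specializes G t g 1) : @nhds G s 1 ≤ @nhds G t 1 := by
  intro U hU
  have := @image_mem_nhds_one_of_isRaikovComplete G _ G t ht _ s hs (MonoidHom.id G) hsep hb hc
    hcomp (continuous_id_iff_le.2 hts) Function.surjective_id hker U hU
  simpa using this

end OpenMapping

/-! ### Rigidity of separable h-complete topologies. -/

section Minimality

variable {G : Type*} [Group G]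

/-- In a separable h-complete group, first-countable coarser group topologies that are comparable
and have the same closure of `1` coincide. -/
theorem IsHComplete.le_of_le {t μ ν : TopologicalSpace G} (hG : @IsHComplete G _ t)
    (ht : @IsTopologicalGroup G t _) (hsep : @TopologicalSpace.SeparableSpace G t)
    (hμ : @IsTopologicalGroup G μ _) (hν : @IsTopologicalGroup G ν _) (htμ : t ≤ μ) (hμν : μ ≤ ν)
    (hμc : (@nhds G μ 1).IsCountablyGenerated) (hνc : (@nhds G ν 1).IsCountablyGenerated)
    (hker : ∀ g, @Specializes G ν g 1 → @Specializes G μ g 1) : ν ≤ μ :=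
  le_of_nhds_one_le hν hμ <| nhds_one_le_of_isRaikovComplete hμ hν hμν hμc
    (separableSpace_of_le htμ hsep) (hG.isRaikovComplete ht hμ htμ)
    (@IsRaikovComplete.baireSpace G _ ν hν (hG.isRaikovComplete ht hν (htμ.trans hμν)) hνc) hker

/-- Pull back the topology of `G ⧸ N`, which is T1 because `N` is closed. -/
theorem exists_coarser_topology_specializes_iff [s : TopologicalSpace G] [IsTopologicalGroup G]
    (N : Subgroup G) [N.Normal] (hN : IsClosed (N : Set G)) :
    ∃ r : TopologicalSpace G, @IsTopologicalGroup G r _ ∧ s ≤ r ∧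
      ∀ g, @Specializes G r g 1 ↔ g ∈ N := by
  refine ⟨.induced (QuotientGroup.mk' N) inferInstance, topologicalGroup_induced _,
    continuous_iff_le_induced.1 QuotientGroup.continuous_mk, fun g ↦ ?_⟩
  have hT1 : T1Space (G ⧸ N) := inferInstance
  rw [@specializes_iff_pure G (.induced _ _), nhds_induced, ← map_le_iff_le_comap, map_pure,
    map_one, ← specializes_iff_pure, specializes_iff_eq]
  exact QuotientGroup.eq_one_iff g

/-- A separable h-complete group has no strictly coarser group topology with the same closed
normal subgroups. -/
theorem IsHComplete.le_of_isClosed_normal {t s : TopologicalSpace G} (hG : @IsHComplete G _ t)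
    (ht : @IsTopologicalGroup G t _) (hsep : @TopologicalSpace.SeparableSpace G t)
    (hs : @IsTopologicalGroup G s _) (hts : t ≤ s)
    (hN : ∀ N : Subgroup G, N.Normal → @IsClosed G t N → @IsClosed G s N) : s ≤ t := by
  refine le_of_nhds_one_le hs ht fun U hU ↦ ?_
  obtain ⟨μ, hμ, htμ, hμc, hUμ⟩ :=
    @exists_countablyGenerated_topology G _ t ht hsep U hU
  -- `N` is the closure of `1` for `μ`. Being closed and normal for `t`, it is closed for `s`, which
  -- yields a topology `r` coarser than `s` with the same closure of `1`.
  let N : Subgroup G := @Subgroup.topologicalClosure G μ _ hμ ⊥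
  have hNn : N.Normal := @Subgroup.is_normal_topologicalClosure G μ _ hμ ⊥ inferInstance
  have hNμ : @IsClosed G μ N := @Subgroup.isClosed_topologicalClosure G μ _ hμ ⊥
  have hNiff : ∀ g, @Specializes G μ g 1 ↔ g ∈ N := by
    intro g
    rw [@specializes_comm G μ _, @specializes_iff_mem_closure G μ]
    rfl
  obtain ⟨r, hr, hsr, hrN⟩ := @exists_coarser_topology_specializes_iff G _ s hs N hNn
    (hN N hNn (hNμ.mono htμ))
  have htr := hts.trans hsr
  have hν : ∀ x : {x // x ∉ N}, ∃ ν : TopologicalSpace G, @IsTopologicalGroup G ν _ ∧ r ≤ ν ∧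
      (@nhds G ν 1).IsCountablyGenerated ∧ ¬ @Specializes G ν x 1 := by
    rintro ⟨x, hx⟩
    rw [← hrN, @specializes_iff_pure G r] at hx
    obtain ⟨W, hW, hxW⟩ := Filter.not_le.1 hx
    obtain ⟨ν, h1, h2, h3, h4⟩ := @exists_countablyGenerated_topology G _ r hr
      (separableSpace_of_le htr hsep) W hW
    refine ⟨ν, h1, h2, h3, fun h ↦ hxW ?_⟩
    exact (@specializes_iff_pure G ν _ _).1 h h4
  choose ν hνg hrν hνc hνx using hν
  have hμν : ∀ x, μ ≤ ν x := by
    intro x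
    have h1 : (@nhds G (μ ⊓ ν x) 1).IsCountablyGenerated := by
      rw [@_root_.nhds_inf G μ (ν x) 1]
      have := hνc x
      infer_instance
    -- Comparing `μ ⊓ ν x` with `μ`: both are first-countable with closure of `1` equal to `N`, so
    -- they coincide.
    refine (hG.le_of_le ht hsep (topologicalGroup_inf hμ (hνg x)) hμ
      (le_inf htμ (htr.trans (hrν x))) inf_le_left h1 hμc fun g hg ↦ ?_).trans inf_le_right
    rw [@specializes_iff_pure G (μ ⊓ ν x), @_root_.nhds_inf G μ (ν x) 1]
    refine le_inf ((@specializes_iff_pure G μ _ _).1 hg) ?_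
    have h2 := (hrN g).2 ((hNiff g).1 hg)
    exact ((@specializes_iff_pure G r _ _).1 h2).trans (nhds_mono (hrν x))
  have hopen : ∀ x, @IsOpen G μ {g | ¬ @Specializes G (ν x) g 1} := by
    intro x
    have h1 : {g | ¬ @Specializes G (ν x) g 1} = (@closure G (ν x) {1})ᶜ := by
      ext g
      rw [mem_compl_iff, ← @specializes_iff_mem_closure G (ν x), mem_ofPred_eq,
        @specializes_comm G (ν x) _]
    rw [h1]
    exact hμν x _ (@isClosed_closure G (ν x) _).isOpen_compl
  have hsc : @SecondCountableTopology G μ :=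
    @secondCountableTopology_of_nhds_one G _ μ hμ (separableSpace_of_le htμ hsep) hμc
  -- By the Lindelöf property countably many `ν x` separate all points outside `N` from `1`. Their
  -- infimum `ρ` is thus first-countable with closure of `1` equal to `N`, which forces `ρ = μ`.
  obtain ⟨T, hT, hTU⟩ := @TopologicalSpace.isOpen_iUnion_countable G μ hsc _ _ hopen
  have hTc : Countable T := hT.to_subtype
  let ρ : TopologicalSpace G := ⨅ x : T, ν x
  have hρr : r ≤ ρ := le_iInf fun x ↦ hrν x
  have hρμ : ρ ≤ μ := by
    refine hG.le_of_le ht hsep hμ (topologicalGroup_iInf fun x : T ↦ hνg x) htμ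
      (le_iInf fun x ↦ hμν x) hμc ?_ fun g hg ↦ ?_
    · rw [_root_.nhds_iInf]
      have := fun x : T ↦ hνc x
      infer_instance
    · by_contra hgN
      rw [hNiff] at hgN
      have h1 : g ∈ ⋃ x, {g | ¬ @Specializes G (ν x) g 1} := mem_iUnion.2 ⟨⟨g, hgN⟩, hνx _⟩
      rw [← hTU] at h1
      obtain ⟨x, hxT, hx⟩ := mem_iUnion₂.1 h1
      apply hx
      rw [@specializes_iff_pure G ρ] at hg
      rw [@specializes_iff_pure G (ν x)]
      exact hg.trans (nhds_mono (iInf_le (fun x : T ↦ ν x) ⟨x, hxT⟩))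
  exact nhds_mono ((hsr.trans hρr).trans hρμ) hUμ

end Minimality

/-! ### Images of closed sets, from separable to arbitrary groups. -/

section Homomorphisms

variable {G : Type u} {H : Type v} [Group G] [TopologicalSpace G]
  [Group H] [TopologicalSpace H] [IsTopologicalGroup H]

theorem IsHereditarilyHComplete.isHComplete (hG : IsHereditarilyHComplete G) : IsHComplete G := by
  intro L _ _ _ _ φ hφ
  have h := hG ⊤ isClosed_univ L (φ.comp (Subgroup.subtype ⊤)) (hφ.comp continuous_subtype_val)
  have h1 : range (φ.comp (Subgroup.subtype ⊤)) = range φ := by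
    ext y
    simp
  rwa [h1] at h

theorem IsHereditarilyHComplete.subgroup (hG : IsHereditarilyHComplete G) (S : Subgroup G)
    (hS : IsClosed (S : Set G)) : IsHereditarilyHComplete S := by
  intro T hT L _ _ _ _ φ hφ
  have hcl : IsClosed ((T.map S.subtype : Subgroup G) : Set G) :=
    hS.isClosedEmbedding_subtypeVal.isClosedMap _ hT
  have hmem : ∀ x : T.map S.subtype, ∃ h : (x : G) ∈ S, (⟨x, h⟩ : S) ∈ T := by
    rintro ⟨_, y, hy, rfl⟩
    exact ⟨y.2, hy⟩
  let e : T.map S.subtype →* T :=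
    { toFun := fun x ↦ ⟨⟨x, (hmem x).1⟩, (hmem x).2⟩
      map_one' := rfl
      map_mul' := fun _ _ ↦ rfl }
  have he : Continuous e := (continuous_subtype_val.subtype_mk _).subtype_mk _
  have hes : Function.Surjective e := fun y ↦ ⟨⟨y.1, y.1, y.2, rfl⟩, rfl⟩
  have h := hG _ hcl L (φ.comp e) (hφ.comp he)
  rwa [MonoidHom.coe_comp, hes.range_comp] at h

theorem IsHereditarilyHComplete.of_surjective {K : Type u} [Group K] [TopologicalSpace K]
    (hG : IsHereditarilyHComplete G) (f : G →* K) (hf : Continuous f)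
    (hsurj : Function.Surjective f) : IsHereditarilyHComplete K := by
  intro T hT L _ _ _ _ φ hφ
  let e : T.comap f →* T := f.subgroupComap T
  have he : Continuous e := (hf.comp continuous_subtype_val).subtype_mk _
  have hes : Function.Surjective e := f.subgroupComap_surjective_of_surjective T hsurj
  have h := hG _ (hT.preimage hf) L (φ.comp e) (hφ.comp he)
  rwa [MonoidHom.coe_comp, hes.range_comp] at h

variable [IsTopologicalGroup G]

theorem IsHereditarilyHComplete.isClosed_image [T2Space H] (hG : IsHereditarilyHComplete G)
    (f : G →* H) (hf : Continuous f) (S : Subgroup G) (hS : IsClosed (S : Set G)) :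
    IsClosed (f '' S) := by
  have h := (hG S hS).isClosed_range (f.comp S.subtype) (hf.comp continuous_subtype_val)
  rwa [MonoidHom.coe_comp, range_comp, Subgroup.coe_subtype, Subtype.range_coe] at h

/-- A continuous injective homomorphism from a separable hereditarily h-complete group is a closed
embedding. -/
theorem IsHereditarilyHComplete.isClosedEmbedding [T2Space H] [TopologicalSpace.SeparableSpace G]
    (hG : IsHereditarilyHComplete G) (f : G →* H) (hf : Continuous f)
    (hinj : Function.Injective f) : Topology.IsClosedEmbedding f := by
  refine ⟨⟨⟨?_⟩, hinj⟩, hG.isHComplete.isClosed_range f hf⟩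
  have hle := continuous_iff_le_induced.1 hf
  refine le_antisymm hle (hG.isHComplete.le_of_isClosed_normal ‹_› ‹_›
    (topologicalGroup_induced f) hle fun N _ hN ↦ ?_)
  rw [isClosed_induced_iff]
  exact ⟨_, hG.isClosed_image f hf N hN, preimage_image_eq _ hinj⟩

/-- A continuous homomorphism from a separable hereditarily h-complete group maps saturated closed
sets to closed sets. -/
theorem IsHereditarilyHComplete.isClosed_image_of_saturated [T2Space H]
    [TopologicalSpace.SeparableSpace G] (hG : IsHereditarilyHComplete G) (f : G →* H)
    (hf : Continuous f) {F : Set G} (hF : IsClosed F)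
    (hsat : ∀ x ∈ F, ∀ y, f x = f y → y ∈ F) : IsClosed (f '' F) := by
  -- Modulo the kernel the map becomes a closed embedding, and saturation keeps the image of `F` in
  -- the quotient closed.
  let q := QuotientGroup.mk' f.ker
  have hq : Topology.IsQuotientMap q := QuotientGroup.isQuotientMap_mk f.ker
  have hQ : IsHereditarilyHComplete (G ⧸ f.ker) :=
    hG.of_surjective q hq.continuous hq.surjective
  let g : G ⧸ f.ker →* H := QuotientGroup.kerLift f
  have hg : Continuous g := hq.continuous_iff.2 hf
  have hginj : Function.Injective g := QuotientGroup.kerLift_injective f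
  have hsep : TopologicalSpace.SeparableSpace (G ⧸ f.ker) :=
    hq.surjective.denseRange.separableSpace hq.continuous
  have hqF : IsClosed (q '' F) := by
    rw [← hq.isClosed_preimage]
    convert hF
    refine Subset.antisymm ?_ (subset_preimage_image _ _)
    rintro y ⟨x, hx, hxy⟩
    exact hsat x hx y (congrArg g hxy)
  have h := (hQ.isClosedEmbedding g hg hginj).isClosedMap _ hqF
  rwa [image_image] at h

/-- Take the closure of the subgroup generated by `D`, which is countable as an image of a free
group on a countable set. -/
theorem exists_separable_closed_subgroup {D : Set G} (hD : D.Countable) :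
    ∃ S : Subgroup G, IsClosed (S : Set G) ∧ TopologicalSpace.SeparableSpace S ∧ D ⊆ S := by
  have : Countable D := hD.to_subtype
  have : Countable (FreeGroup D) := inferInstanceAs (Countable (Quot _))
  let R := (FreeGroup.lift (Subtype.val : D → G)).range
  have hR : Countable R := (MonoidHom.rangeRestrict_surjective _).countable
  have hsub : (R : Set G) ⊆ R.topologicalClosure := R.le_topologicalClosure
  refine ⟨R.topologicalClosure, R.isClosed_topologicalClosure, ?_, fun x hx ↦
    hsub ⟨FreeGroup.of ⟨x, hx⟩, by simp⟩⟩
  have hd : DenseRange (inclusion hsub) := (denseRange_inclusion_iff hsub).2 Subset.rfl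
  have : Countable (R : Set G) := hR
  exact hd.separableSpace (continuous_inclusion hsub)

/-- A continuous homomorphism from a hereditarily h-complete group maps saturated closed sets to
ω-closed sets. -/
theorem IsHereditarilyHComplete.isOmegaClosed_image [T2Space H] (hG : IsHereditarilyHComplete G)
    (f : G →* H) (hf : Continuous f) {F : Set G} (hF : IsClosed F)
    (hsat : ∀ x ∈ F, ∀ y, f x = f y → y ∈ F) : IsOmegaClosed (f '' F) := by
  intro C hC hCF
  obtain ⟨D, hDF, hD, rfl⟩ : ∃ D ⊆ F, D.Countable ∧ f '' D = C := by
    choose! g hgF hg using hCF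
    exact ⟨g '' C, image_subset_iff.2 hgF, hC.image g, by
      rw [image_image, image_congr hg, image_id']⟩
  obtain ⟨S, hS, hSs, hDS⟩ := exists_separable_closed_subgroup hD
  have h := (hG.subgroup S hS).isClosed_image_of_saturated (f.comp S.subtype)
    (hf.comp continuous_subtype_val) (F := Subtype.val ⁻¹' F)
    (hF.preimage continuous_subtype_val) fun x hx y hxy ↦ hsat x hx y hxy
  rw [MonoidHom.coe_comp, image_comp] at h
  have hsub : Subtype.val '' ((Subtype.val : S → G) ⁻¹' F) ⊆ F := image_preimage_subset _ _
  refine (closure_minimal ?_ h).trans (image_mono hsub)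
  refine image_mono fun x hx ↦ ⟨⟨x, hDS hx⟩, hDF hx, rfl⟩

end Homomorphisms

/-! ### A sequential criterion for compactness. -/

section Compactness

variable {G : Type*} [Group G] [TopologicalSpace G] [IsTopologicalGroup G]

/-- If every sequence in `L` lies in a compact set, then each ultrafilter on `L` is Cauchy. -/
theorem isRaikovCauchy_of_forall_seq {L : Set G}
    (hL : ∀ x : ℕ → G, (∀ n, x n ∈ L) → ∃ K, IsCompact K ∧ ∀ n, x n ∈ K) {Ω : Ultrafilter G}
    (hΩ : L ∈ Ω) : IsRaikovCauchy (Ω : Filter G) := by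
  have key : ∀ r : G → G → Prop, (∀ c, ∃ P ∈ 𝓝 c, ∀ y ∈ P, ∀ z ∈ P, r y z) →
      ∃ x, {y | r x y} ∈ Ω := by
    intro r hr
    by_contra! h
    -- If every `{y | r x y}` is missed by `Ω`, finite intersections of complements allow a
    -- recursive choice of a sequence in `L` with `¬ r (x m) (x n)` for `m < n`. A cluster point of
    -- it contradicts the local hypothesis on `r`.
    obtain ⟨x, hxL, hx⟩ := exists_seq_of_forall_finset_exists (· ∈ L) (fun x y ↦ ¬ r x y) (by
      intro s _
      have h1 : L ∩ ⋂ x ∈ s, {y | r x y}ᶜ ∈ Ω := by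
        refine inter_mem hΩ ((biInter_finset_mem s).2 fun x _ ↦ ?_)
        exact Ultrafilter.compl_mem_iff_notMem.2 (h x)
      obtain ⟨y, hyL, hy⟩ := Ω.nonempty_of_mem h1
      exact ⟨y, hyL, fun x hx ↦ mem_iInter₂.1 hy x hx⟩)
    obtain ⟨K, hK, hxK⟩ := hL x hxL
    obtain ⟨c, -, hc⟩ := hK.exists_mapClusterPt_of_frequently
      (l := atTop) (f := x) (Frequently.of_forall hxK)
    obtain ⟨P, hP, hPr⟩ := hr c
    have hfreq := hc.frequently hP
    obtain ⟨m, hm⟩ := hfreq.exists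
    obtain ⟨n, hmn, hn⟩ := frequently_atTop'.1 hfreq m
    exact hx m n hmn (hPr _ hm _ hn)
  constructor
  · intro U hU
    obtain ⟨V, hV, hVU⟩ := exists_nhds_split_inv hU
    obtain ⟨x, hx⟩ := key (fun y z ↦ z⁻¹ * y ∈ V) fun c ↦ by
      obtain ⟨P, hP, hPV⟩ := (𝓝 c).basis_sets.prod_self.tendsto_left_iff.1
        (isRaikovCauchy_nhds c).1 _ hV
      exact ⟨P, hP, fun y hy z hz ↦ hPV (mk_mem_prod hz hy)⟩
    rw [mem_map]
    filter_upwards [prod_mem_prod hx hx] with p hp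
    have := hVU _ hp.1 _ hp.2
    simpa [div_eq_mul_inv] using this
  · intro U hU
    obtain ⟨V, hV, hVU⟩ := exists_nhds_split_inv hU
    obtain ⟨x, hx⟩ := key (fun y z ↦ z * y⁻¹ ∈ V) fun c ↦ by
      obtain ⟨P, hP, hPV⟩ := (𝓝 c).basis_sets.prod_self.tendsto_left_iff.1
        (isRaikovCauchy_nhds c).2 _ hV
      exact ⟨P, hP, fun y hy z hz ↦ hPV (mk_mem_prod hz hy)⟩
    rw [mem_map]
    filter_upwards [prod_mem_prod hx hx] with p hp
    have := hVU _ hp.1 _ hp.2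
    simpa [div_eq_mul_inv] using this

/-- In a Raikov complete group, a closed set all of whose sequences lie in compact sets is
compact. -/
theorem IsRaikovComplete.isCompact_of_forall_seq (hG : IsRaikovComplete G) {L : Set G}
    (hLc : IsClosed L)
    (hL : ∀ x : ℕ → G, (∀ n, x n ∈ L) → ∃ K, IsCompact K ∧ ∀ n, x n ∈ K) : IsCompact L := by
  refine isCompact_iff_ultrafilter_le_nhds.2 fun Ω hΩ ↦ ?_
  have hΩL : L ∈ Ω := le_principal_iff.1 hΩ
  obtain ⟨x, hx⟩ := hG Ω Ω.neBot (isRaikovCauchy_of_forall_seq hL hΩL)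
  exact ⟨x, hLc.mem_of_frequently_of_tendsto (f := id) (Eventually.frequently hΩL) hx, hx⟩

end Compactness

/-! ### The two cases of the theorem. -/

section OpenMaps

variable {G : Type u} {H : Type v} [Group G] [TopologicalSpace G] [IsTopologicalGroup G]
  [Group H] [TopologicalSpace H] [IsTopologicalGroup H] [T2Space H]

theorem IsHereditarilyHComplete.isOpenMap_of_hasCountableTightness
    (hG : IsHereditarilyHComplete G) (f : G →* H) (hf : Continuous f)
    (hsurj : Function.Surjective f) (hH : HasCountableTightness H) : IsOpenMap f := by
  have hq : Topology.IsQuotientMap f := by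
    refine Topology.isQuotientMap_iff_isClosed.2
      ⟨hsurj, fun s ↦ ⟨fun h ↦ h.preimage hf, fun h ↦ ?_⟩⟩
    rw [← image_preimage_eq s hsurj]
    refine hH _ (hG.isOmegaClosed_image f hf h fun x hx y hxy ↦ ?_)
    rwa [mem_preimage, ← hxy]
  exact (MonoidHom.isOpenQuotientMap_of_isQuotientMap hq).isOpenMap

/-- A continuous injective homomorphism from a hereditarily h-complete group pulls compact sets back
to compact sets. -/
theorem IsHereditarilyHComplete.isCompact_preimage (hG : IsHereditarilyHComplete G) (f : G →* H)
    (hf : Continuous f) (hinj : Function.Injective f) {K : Set H} (hK : IsCompact K) :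
    IsCompact (f ⁻¹' K) := by
  have hcomp : IsRaikovComplete G := hG.isHComplete.isRaikovComplete ‹_› ‹_› le_rfl
  refine hcomp.isCompact_of_forall_seq (hK.isClosed.preimage hf) fun x hx ↦ ?_
  -- On a separable closed subgroup containing the sequence `f` is a closed embedding, so the part
  -- of the preimage of `K` in it is compact.
  obtain ⟨S, hS, hSs, hxS⟩ := exists_separable_closed_subgroup (countable_range x)
  have he := (hG.subgroup S hS).isClosedEmbedding (f.comp S.subtype)
    (hf.comp continuous_subtype_val) (hinj.comp Subtype.val_injective)
  refine ⟨_, (he.isCompact_preimage hK).image continuous_subtype_val, fun n ↦ ?_⟩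
  exact ⟨⟨x n, hxS ⟨n, rfl⟩⟩, hx n, rfl⟩

theorem IsHereditarilyHComplete.isOpenMap_of_isKGroup (hG : IsHereditarilyHComplete G)
    (f : G →* H) (hf : Continuous f) (hsurj : Function.Surjective f) (hH : IsKGroup H) :
    IsOpenMap f := by
  have hker : IsClosed (f.ker : Set G) := isClosed_singleton.preimage hf
  let q := QuotientGroup.mk' f.ker
  have hq : Topology.IsQuotientMap q := QuotientGroup.isQuotientMap_mk f.ker
  have hQ : IsHereditarilyHComplete (G ⧸ f.ker) :=
    hG.of_surjective q hq.continuous hq.surjective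
  let e : G ⧸ f.ker ≃* H := QuotientGroup.quotientKerEquivOfSurjective f hsurj
  have he : Continuous e := hq.continuous_iff.2 hf
  have hk : IsKContinuous e.symm := by
    intro K hK
    have hL := hQ.isCompact_preimage e.toMonoidHom he e.injective hK
    refine continuousOn_iff_isClosed.2 fun F hF ↦
      ⟨e '' (e ⁻¹' K ∩ F), ((hL.inter_right hF).image he).isClosed, ?_⟩
    ext y
    constructor
    · rintro ⟨hy, hyK⟩
      exact ⟨⟨e.symm y, ⟨by simpa using hyK, hy⟩, by simp⟩, hyK⟩
    · rintro ⟨⟨x, ⟨-, hx⟩, rfl⟩, hyK⟩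
      exact ⟨by simpa using hx, hyK⟩
  have hsymm : Continuous e.symm := by
    -- The domain of `e` may lie in another universe, so its topology is transported to `H` before
    -- the k-group property is applied to the identity.
    have hk' : @IsKContinuous H H _ (.induced e.symm inferInstance) (MonoidHom.id H) := by
      intro K hK x hx
      change Tendsto id (𝓝[K] x) (@nhds H (.induced e.symm inferInstance) x)
      rw [nhds_induced e.symm x, tendsto_comap_iff]
      exact hk K hK x hx
    have hT2 : @T2Space H (.induced e.symm inferInstance) :=
      @T2Space.of_injective_continuous H _ (.induced e.symm inferInstance) _ _ _
        e.symm.injective continuous_induced_dom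
    exact continuous_iff_le_induced.2 <| continuous_id_iff_le.1 <|
      @hH H _ (.induced e.symm inferInstance) (topologicalGroup_induced e.symm) hT2 (MonoidHom.id H) hk'
  have hopen : IsOpenMap q := QuotientGroup.isOpenMap_coe
  have h : IsOpenMap e := IsOpenMap.of_inverse hsymm e.apply_symm_apply e.symm_apply_apply
  exact h.comp hopen

end OpenMaps

theorem mainTheorem1 {G : Type u} {H : Type v}
    [Group G] [TopologicalSpace G] [IsTopologicalGroup G] [T2Space G]
    [Group H] [TopologicalSpace H] [IsTopologicalGroup H] [T2Space H]
    (hG : IsHereditarilyHComplete G)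
    (f : G →* H) (hf : Continuous f) (hsurj : Function.Surjective f)
    (hH : HasCountableTightness H ∨ IsKGroup H) :
    IsOpenMap f :=
  hH.elim (hG.isOpenMap_of_hasCountableTightness f hf hsurj)
    (hG.isOpenMap_of_isKGroup f hf hsurj)
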